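/- For $t\ge 1$, a $t$-color partition of an integer $n\ge 0$ is a pair $(\alpha,c)$, where $\alpha=(\alpha_1\ge\alpha_2\ge\dots\ge\alpha_l\ge 1)$ is a partition of $n$ (the empty partition if $n=0$) and $c$ assigns to each $i\in\{1,\dots,l\}$ a color $c(i)\in\{1,\dots,t\}$ such that $c(i)\le c(i+1)$ whenever $\alpha_i=\alpha_{i+1}$. Let $k\ge 2$, $0<r\le k$ and $N\ge 0$ be integers and put $M=2k$. Let $C_n(M,r)$ be the set of $(k-1)$-color partitions $(\alpha,c)$ of $n$ such that (i) for $1\le i\le l$: $\alpha_i>|2c(i)-r+1|$ if $\alpha_i\equiv r\pmod 2$, and $\alpha_i>|2c(i)-r|$ otherwise; (ii) for $1\le i<l$: $\alpha_i-\alpha_{i+1}\ge 2+|2(c(i)-c(i+1))|$ if $\alpha_i\equiv\alpha_{i+1}\pmod 2$; $\alpha_i-\alpha_{i+1}\ge 2+|2(c(i)-c(i+1))-1|$ if $\alpha_i\not\equiv\alpha_{i+1}\equiv r\pmod 2$; and $\alpha_i-\alpha_{i+1}\ge 2+|2(c(i)-c(i+1))+1|$ if $\alpha_{i+1}\not\equiv\alpha_i\equiv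 r\pmod 2$; (iii) for $1\le i\le l$: if $c(i)=k-1$, then $\alpha_i\not\equiv r\pmod 2$. Let $D_n$ be the set of all $(\alpha,c)\in C_n(M,r)$ that are empty or satisfy in addition (iv) $(2N+k-r-1)-\alpha_1\ \ge\ \left|2c(1)-k+\tfrac12\right|-\tfrac12$. Then each $D_n$ is finite, and $$\sum_{j=-\infty}^{\infty}(-1)^j q^{j(kj+k-r)}\begin{bmatrix}2N+k-r\\ N-kj\end{bmatrix}_q=\sum_{n\ge 0}|D_n|\,q^n,$$ where $\begin{bmatrix}a\\ b\end{bmatrix}_q=\dfrac{(q)_a}{(q)_b(q)_{a-b}}$ with $(q)_m=\prod_{i=1}^m(1-q^i)$ if $0\le b\le a$, and $\begin{bmatrix}a\\ b\end{bmatrix}_q=0$ otherwise. -/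

import Mathlib

open Polynomial

/-- A `t`-color partition of `n`, written as the list of pairs `(αᵢ, c(i))` of a part and its
color: the parts are positive and non-increasing with sum `n`, the colors lie in `{1, …, t}`, and
colors are non-decreasing along consecutive equal parts. -/
@[ext]
structure ColorPartition (t n : ℕ) where
  /-- The list `(α₁, c(1)), …, (α_l, c(l))`. -/
  toList : List (ℕ × ℕ)
  part_pos : ∀ x ∈ toList, 1 ≤ x.1
  color_mem : ∀ x ∈ toList, 1 ≤ x.2 ∧ x.2 ≤ t
  sorted : toList.IsChain (fun x y => y.1 ≤ x.1 ∧ (x.1 = y.1 → x.2 ≤ y.2))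
  sum_eq : (toList.map Prod.fst).sum = n

namespace ColorPartition

/-- Initial condition on a part `a` of color `c`. -/
def InitialCondition (r a c : ℕ) : Prop :=
  (a ≡ r [MOD 2] → (a : ℤ) > |2 * (c : ℤ) - r + 1|) ∧
  (¬ a ≡ r [MOD 2] → (a : ℤ) > |2 * (c : ℤ) - r|)

/-- Color difference condition on consecutive parts `a`, `b` of colors `c`, `d`. -/
def DifferenceCondition (r a c b d : ℕ) : Prop :=
  (a ≡ b [MOD 2] → (a : ℤ) - b ≥ 2 + |2 * ((c : ℤ) - d)|) ∧
  (¬ a ≡ b [MOD 2] ∧ b ≡ r [MOD 2] → (a : ℤ) - b ≥ 2 + |2 * ((c : ℤ) - d) - 1|) ∧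
  (¬ a ≡ b [MOD 2] ∧ a ≡ r [MOD 2] → (a : ℤ) - b ≥ 2 + |2 * ((c : ℤ) - d) + 1|)

/-- Parity condition on a part `a` of color `c`, when `M` is even and `c` is the last color. -/
def ParityCondition (M r a c : ℕ) : Prop :=
  Even M → c = M / 2 - 1 → ¬ a ≡ r [MOD 2]

/-- The set `C_n(M, r)` of `(k - 1)`-color partitions of `n`, where `k = ⌊M / 2⌋`. -/
def C (M r n : ℕ) : Set (ColorPartition (M / 2 - 1) n) :=
  {p | (∀ x ∈ p.toList, InitialCondition r x.1 x.2) ∧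
    p.toList.IsChain (fun x y => DifferenceCondition r x.1 x.2 y.1 y.2) ∧
    (∀ x ∈ p.toList, ParityCondition M r x.1 x.2)}

/-- The bound `(2N + k - r - 1) - α₁ ≥ |2 c(1) - k + 1/2| - 1/2` on the first part and its color
(no condition on the empty partition). -/
def FirstPartBound {t n : ℕ} (N k r : ℕ) (p : ColorPartition t n) : Prop :=
  ∀ x ∈ p.toList.head?,
    (2 * (N : ℚ) + k - r - 1) - x.1 ≥ |2 * (x.2 : ℚ) - k + 1 / 2| - 1 / 2

end ColorPartition

/-- The `q`-binomial coefficient `[n choose m]_q` as a polynomial in `q = X`, through the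
`q`-Pascal rule; `qBinom_mul` below is the usual quotient formula. -/
noncomputable def qBinom : ℕ → ℕ → ℤ[X]
  | _, 0 => 1
  | 0, _ + 1 => 0
  | n + 1, m + 1 => qBinom n m + X ^ (m + 1) * qBinom n (m + 1)

/-- `(q)_n = (1 - q)(1 - q²) ⋯ (1 - qⁿ)`. -/
noncomputable def qFact (n : ℕ) : ℤ[X] := ∏ i ∈ Finset.range n, (1 - X ^ (i + 1))

theorem qBinom_eq_zero : ∀ {n m : ℕ}, n < m → qBinom n m = 0
  | _, 0, h => absurd h (Nat.not_lt_zero _)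
  | 0, _ + 1, _ => by simp [qBinom]
  | n + 1, m + 1, h => by
    rw [qBinom, qBinom_eq_zero (by omega : n < m), qBinom_eq_zero (by omega : n < m + 1)]
    simp

/-- `[n choose m]_q = (q)_n / ((q)_m (q)_{n-m})` for `m ≤ n`, with `n = m + l`. -/
theorem qBinom_mul : ∀ m l : ℕ, qBinom (m + l) m * (qFact m * qFact l) = qFact (m + l)
  | 0, l => by simp [qBinom, qFact]
  | m + 1, 0 => by
    have h := qBinom_mul m 0
    have e : qBinom (m + 1 + 0) (m + 1) = qBinom m m := by
      rw [add_zero, qBinom, qBinom_eq_zero (by omega : m < m + 1)]; simp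
    rw [e]
    simp only [add_zero, qFact, Finset.prod_range_succ, Finset.prod_range_zero] at h ⊢
    linear_combination (1 - X ^ (m + 1)) * h
  | m + 1, l + 1 => by
    have h1 := qBinom_mul m (l + 1)
    have h2 := qBinom_mul (m + 1) l
    have e : m + 1 + (l + 1) = (m + (l + 1)) + 1 := by omega
    have e2 : m + 1 + l = m + (l + 1) := by omega
    rw [e2] at h2
    rw [e, qBinom]
    have f : ∀ n, qFact (n + 1) = qFact n * (1 - X ^ (n + 1)) := fun n => by
      simp [qFact, Finset.prod_range_succ]
    rw [f (m + (l + 1)), f m, f l]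
    rw [f l] at h1
    rw [f m] at h2
    rw [show m + (l + 1) + 1 = (m + 1) + (l + 1) by omega, pow_add X (m + 1) (l + 1)]
    linear_combination (1 - X ^ (m + 1)) * h1 + X ^ (m + 1) * (1 - X ^ (l + 1)) * h2

/-- `[n choose m]_q` for an integer `m`; it is zero unless `0 ≤ m ≤ n`. -/
noncomputable def qBinomInt (n : ℕ) (m : ℤ) : ℤ[X] :=
  if 0 ≤ m then qBinom n m.toNat else 0

/-- The summand `(-1)^j q^{j(kj + k - r)} [2N + k - r choose N - kj]_q`, for `r ≤ k`, where the
exponent `j(kj + k - r)` is nonnegative. -/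
noncomputable def finitizedTerm (N k r : ℕ) (j : ℤ) : ℤ[X] :=
  ((Int.negOnePow j : ℤˣ) : ℤ) •
    (X ^ (j * (k * j + k - r)).toNat * qBinomInt (2 * N + k - r) (N - k * j))

theorem finitizedExponent_nonneg {k r : ℕ} (hrk : r ≤ k) (j : ℤ) :
    0 ≤ j * ((k : ℤ) * j + k - r) := by
  have h : (r : ℤ) ≤ k := by exact_mod_cast hrk
  rcases le_or_gt 0 j with hj | hj
  · have : 0 ≤ (k : ℤ) * j := by positivity
    exact mul_nonneg hj (by linarith)
  · have : (k : ℤ) * (j + 1) ≤ 0 :=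
      mul_nonpos_of_nonneg_of_nonpos (by positivity) (by omega)
    have h0 : (0 : ℤ) ≤ r := by positivity
    exact mul_nonneg_of_nonpos_of_nonpos hj.le (by linarith)

/-- Only finitely many summands are nonzero. -/
theorem finitizedTerm_support_finite {k : ℕ} (hk : 0 < k) (N r : ℕ) :
    (Function.support (finitizedTerm N k r)).Finite := by
  refine (Set.finite_Icc (-(2 * N + k : ℤ)) N).subset fun j hj => ?_
  have hk' : (1 : ℤ) ≤ k := by exact_mod_cast hk
  by_contra hj'
  apply hj
  have key : qBinomInt (2 * N + k - r) (N - k * j) = 0 := by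
    unfold qBinomInt
    split_ifs with h
    · apply qBinom_eq_zero
      rw [Int.lt_toNat]
      rcases lt_or_ge (N : ℤ) j with h1 | h1
      · nlinarith
      · have h2 : j < -(2 * N + k : ℤ) := by
          by_contra h3
          exact hj' ⟨not_lt.mp h3, h1⟩
        have : ((2 * N + k - r : ℕ) : ℤ) ≤ 2 * N + k := by omega
        nlinarith
    · rfl
  simp [finitizedTerm, key]

/-- The sum `∑_{j ∈ ℤ} (-1)^j q^{j(kj + k - r)} [2N + k - r choose N - kj]_q`. -/
noncomputable def finitizedSum (N k r : ℕ) : ℤ[X] := ∑ᶠ j : ℤ, finitizedTerm N k r j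

/-! Both sides solve the same discrete boundary value problem in the strip 0 ≤ y ≤ 2k - 2. A part
`a` of color `c` becomes a peak at position `a` of height 2c or 2c - 1, by parity. Conditions (i),
(ii) and (iv) then all say x - b ≥ 2 + |y - h| for two peaks, with a virtual peak at each end, and
(iii) with the color range confines heights to [1, 2k - 3].

Let the last virtual peak (x, y) vary. For n + y ≡ r mod 2 the generating function satisfies G(n+2,
y) = G(n+1, y-1) + G(n+1, y+1) - (1 - q^n) G(n, y) inside the strip (`peakGenFun_recurrence`), and
G(n+2, 0) = G(n+1, 1), G(n+2, 2k-2) = G(n+1, 2k-3) on its boundary (`peakLists_lower`,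
`peakLists_upper`).

The q-binomials satisfy the same recurrence (`qBinomInt_recurrence`). Shifts and signed weights are
chosen, as in the reflection principle, so that the boundary equations hold by pairwise cancellation
(`imageSum_lower`, `imageSum_upper`). Induction on n identifies the two solutions
(`peakGenFun_eq_imageSum`); the theorem is the value at (2N + k - r + 1, k - 1). -/

/-! ### q-binomial coefficients with integer lower index -/

theorem qFact_ne_zero (n : ℕ) : qFact n ≠ 0 := by
  refine Finset.prod_ne_zero_iff.2 fun i _ h => ?_
  have := congrArg (Polynomial.eval 0) h
  simp at this

theorem qBinom_symm (m l : ℕ) : qBinom (m + l) m = qBinom (m + l) l := by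
  have h1 := qBinom_mul m l
  have h2 := qBinom_mul l m
  rw [add_comm l m] at h2
  refine mul_right_cancel₀ (mul_ne_zero (qFact_ne_zero m) (qFact_ne_zero l)) ?_
  rw [h1, mul_comm (qFact m), h2]

theorem qBinomInt_of_neg {n : ℕ} {m : ℤ} (h : m < 0) : qBinomInt n m = 0 :=
  if_neg (not_le.2 h)

theorem qBinomInt_of_lt {n : ℕ} {m : ℤ} (h : (n : ℤ) < m) : qBinomInt n m = 0 := by
  rw [qBinomInt, if_pos (by omega), qBinom_eq_zero (by omega)]

theorem qBinomInt_natCast (n m : ℕ) : qBinomInt n m = qBinom n m := by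
  simp [qBinomInt]

theorem qBinomInt_symm (n : ℕ) (m : ℤ) : qBinomInt n (n - m) = qBinomInt n m := by
  rcases lt_or_ge m 0 with h | h
  · rw [qBinomInt_of_neg h, qBinomInt_of_lt (by omega)]
  rcases lt_or_ge (n : ℤ) m with h' | h'
  · rw [qBinomInt_of_lt h', qBinomInt_of_neg (by omega)]
  lift m to ℕ using h
  obtain ⟨l, rfl⟩ := Nat.exists_eq_add_of_le (by exact_mod_cast h' : m ≤ n)
  rw [show ((m + l : ℕ) : ℤ) - m = l by push_cast; ring, qBinomInt_natCast, qBinomInt_natCast,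
    qBinom_symm]

/-- The `q`-Pascal rule for integer lower index. -/
theorem qBinomInt_succ (n : ℕ) (m : ℤ) :
    qBinomInt (n + 1) m = qBinomInt n (m - 1) + X ^ m.toNat * qBinomInt n m := by
  rcases lt_trichotomy m 0 with h | rfl | h
  · simp [qBinomInt_of_neg h, qBinomInt_of_neg (show m - 1 < 0 by omega)]
  · rw [qBinomInt_of_neg (show (0 : ℤ) - 1 < 0 by omega)]
    simp [qBinomInt, qBinom]
  · obtain ⟨p, rfl⟩ : ∃ p : ℕ, m = p + 1 := ⟨(m - 1).toNat, by omega⟩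
    rw [show (p : ℤ) + 1 - 1 = p by ring, ← Nat.cast_succ, qBinomInt_natCast, qBinomInt_natCast,
      qBinomInt_natCast, Int.toNat_natCast, qBinom]

/-- The other `q`-Pascal rule for integer lower index. -/
theorem qBinomInt_succ' (n : ℕ) (m : ℤ) :
    qBinomInt (n + 1) m =
      qBinomInt n m + X ^ (n + 1 - m).toNat * qBinomInt n (m - 1) := by
  rw [← qBinomInt_symm, qBinomInt_succ, ← qBinomInt_symm n m, ← qBinomInt_symm n (m - 1)]
  push_cast
  rw [show (n : ℤ) + 1 - m - 1 = n - m by ring, show (n : ℤ) - (m - 1) = n + 1 - m by ring]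

theorem one_sub_mul_qBinomInt (n : ℕ) (m : ℤ) :
    (1 - X ^ m.toNat) * qBinomInt (n + 1) m = (1 - X ^ (n + 1)) * qBinomInt n (m - 1) := by
  rcases le_or_gt m 0 with h | h
  · rw [qBinomInt_of_neg (show m - 1 < 0 by omega), Int.toNat_of_nonpos h]
    simp
  rcases lt_or_ge ((n : ℤ) + 1) m with h' | h'
  · rw [qBinomInt_of_lt (by push_cast; omega), qBinomInt_of_lt (by omega)]
    simp
  have h1 := qBinomInt_succ n m
  have h2 := qBinomInt_succ' n m
  have h3 : (X : ℤ[X]) ^ (n + 1) = X ^ m.toNat * X ^ (n + 1 - m).toNat := by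
    rw [← pow_add]; congr 1; omega
  rw [h3]
  linear_combination h1 - X ^ m.toNat * h2

/-- Three-term recurrence of the `q`-binomial coefficients. -/
theorem qBinomInt_recurrence (n : ℕ) (m : ℤ) :
    qBinomInt (n + 1) m =
      qBinomInt n m + qBinomInt n (m - 1) - (1 - X ^ n) * qBinomInt (n - 1) (m - 1) := by
  have h1 := qBinomInt_succ n m
  rcases n with _ | n
  · rcases eq_or_ne m 0 with rfl | h
    · rw [h1]; simp; ring
    · have : qBinomInt 0 m = 0 := by
        rcases lt_or_gt_of_ne h with h | h
        · exact qBinomInt_of_neg h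
        · exact qBinomInt_of_lt (by simpa using h)
      rw [h1, this]; simp
  · rw [h1, Nat.add_sub_cancel]
    linear_combination -(one_sub_mul_qBinomInt n m)

/-! ### The method of images -/

/-- Positions of the images of the starting point under the two reflections. -/
def imageShift (k r : ℕ) (j : ℤ) : ℤ := if Even j then k * j else r - k * (j + 1)

theorem imageShift_even (k r : ℕ) (i : ℤ) : imageShift k r (2 * i) = 2 * k * i := by
  rw [imageShift, if_pos (even_two_mul i)]; ring

theorem imageShift_odd (k r : ℕ) (i : ℤ) : imageShift k r (2 * i - 1) = r - 2 * k * i := by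
  rw [imageShift, if_neg (by rw [Int.not_even_iff]; omega)]; ring

theorem int_eq_even_or_odd (j : ℤ) : (∃ i, j = 2 * i) ∨ ∃ i, j = 2 * i - 1 := by
  rcases Int.emod_two_eq_zero_or_one j with h | h
  · exact .inl ⟨j / 2, by omega⟩
  · exact .inr ⟨(j + 1) / 2, by omega⟩

theorem two_mul_mul_ne {k r : ℕ} (hr : 0 < r) (hrk : r < 2 * k) (t : ℤ) :
    2 * (k : ℤ) * t ≠ r := by
  intro h
  have h1 : (0 : ℤ) < r := by exact_mod_cast hr
  have h2 : (r : ℤ) < 2 * k := by exact_mod_cast hrk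
  rcases le_or_gt t 0 with ht | ht <;> nlinarith

theorem imageShift_injective {k r : ℕ} (hr : 0 < r) (hrk : r < 2 * k) :
    Function.Injective (imageShift k r) := by
  have hk : (2 * (k : ℤ)) ≠ 0 := by omega
  intro a b h
  rcases int_eq_even_or_odd a with ⟨a, rfl⟩ | ⟨a, rfl⟩ <;>
    rcases int_eq_even_or_odd b with ⟨b, rfl⟩ | ⟨b, rfl⟩ <;>
    simp only [imageShift_even, imageShift_odd] at h
  · rw [mul_left_cancel₀ hk h]
  · exact absurd (by linarith) (two_mul_mul_ne hr hrk (a + b))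
  · exact absurd (by linarith) (two_mul_mul_ne hr hrk (a + b))
  · rw [mul_left_cancel₀ hk (by linarith : 2 * (k : ℤ) * a = 2 * k * b)]

/-- The signed weight of an image. -/
noncomputable def imageWeight (k r : ℕ) (j : ℤ) : ℤ[X] :=
  ((Int.negOnePow j : ℤˣ) : ℤ) • X ^ (j * (k * j + k - r)).toNat

/-- The image sum for paths of length `n` with `m` down steps. -/
noncomputable def imageSum (k r n : ℕ) (m : ℤ) : ℤ[X] :=
  ∑ᶠ j : ℤ, imageWeight k r j * qBinomInt n (m - imageShift k r j)

section

variable {k r : ℕ}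

theorem imageSum_support_finite (hr : 0 < r) (hrk : r < 2 * k) (n : ℕ) (m : ℤ)
    (c : ℤ → ℤ[X]) :
    (Function.support fun j => c j * qBinomInt n (m - imageShift k r j)).Finite := by
  refine ((Set.finite_Icc (m - n) m).preimage (imageShift_injective hr hrk).injOn).subset
    fun j hj => ?_
  by_contra h
  apply hj
  have : qBinomInt n (m - imageShift k r j) = 0 := by
    by_cases h1 : m - imageShift k r j < 0
    · exact qBinomInt_of_neg h1
    · refine qBinomInt_of_lt ?_
      by_contra h2
      exact h ⟨by omega, by omega⟩
  simp [this]

/-- The coefficients in `qBinomInt_recurrence` do not involve the lower index, so the recurrence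
survives shifts and linear combinations. -/
theorem imageSum_recurrence (hr : 0 < r) (hrk : r < 2 * k) (n : ℕ) (m : ℤ) :
    imageSum k r (n + 1) m = imageSum k r n m + imageSum k r n (m - 1) -
      (1 - X ^ n) * imageSum k r (n - 1) (m - 1) := by
  have F := fun n m => imageSum_support_finite hr hrk n m (imageWeight k r)
  unfold imageSum
  rw [mul_finsum, ← finsum_add_distrib (F _ _) (F _ _), ← finsum_sub_distrib]
  · refine finsum_congr fun j => ?_
    rw [qBinomInt_recurrence, show m - imageShift k r j - 1 = m - 1 - imageShift k r j by ring]
    ring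
  · exact ((F n m).union (F n (m - 1))).subset (Function.support_add _ _)
  · exact (F (n - 1) (m - 1)).subset (Function.support_mul_subset_right _ _)

theorem finsum_eq_zero_of_equiv_neg {f : ℤ → ℤ[X]} (e : ℤ ≃ ℤ) (h : ∀ j, f (e j) = -f j) :
    ∑ᶠ j, f j = 0 := by
  have h1 := finsum_comp_equiv e (f := f)
  simp only [h, finsum_neg_distrib] at h1
  exact self_eq_neg.1 h1.symm

/-- The reflection in the lower boundary, exchanging `2 * i` and `2 * i - 1`. -/
def lowerSwap : ℤ ≃ ℤ where
  toFun j := if Even j then j - 1 else j + 1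
  invFun j := if Even j then j - 1 else j + 1
  left_inv j := by simp only [Int.even_iff]; split_ifs <;> omega
  right_inv j := by simp only [Int.even_iff]; split_ifs <;> omega

/-- The reflection in the upper boundary, exchanging `2 * i` and `2 * i + 1`. -/
def upperSwap : ℤ ≃ ℤ where
  toFun j := if Even j then j + 1 else j - 1
  invFun j := if Even j then j + 1 else j - 1
  left_inv j := by simp only [Int.even_iff]; split_ifs <;> omega
  right_inv j := by simp only [Int.even_iff]; split_ifs <;> omega

theorem imageShift_lowerSwap (j : ℤ) :
    imageShift k r (lowerSwap j) = r - imageShift k r j := by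
  simp only [imageShift, lowerSwap, Equiv.coe_fn_mk]
  split_ifs with h1 h2 h2 <;> simp only [Int.even_iff] at h1 h2 <;> first | omega | ring

theorem imageShift_upperSwap (j : ℤ) :
    imageShift k r (upperSwap j) = r - 2 * k - imageShift k r j := by
  simp only [imageShift, upperSwap, Equiv.coe_fn_mk]
  split_ifs with h1 h2 h2 <;> simp only [Int.even_iff] at h1 h2 <;> first | omega | ring

theorem imageWeight_mul_pow_eq_neg (hrk : r ≤ k) {j j' : ℤ} {a b : ℕ} (hj : Odd (j' - j))
    (h : j' * (k * j' + k - r) + a = j * (k * j + k - r) + b) :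
    imageWeight k r j' * X ^ a = -(imageWeight k r j * X ^ b) := by
  have h1 := finitizedExponent_nonneg hrk j
  have h2 := finitizedExponent_nonneg hrk j'
  have h3 : Int.negOnePow j' = -Int.negOnePow j := by
    rw [show j' = j' - j + j by ring, Int.negOnePow_add, Int.negOnePow_odd _ hj, neg_one_mul]
  rw [imageWeight, imageWeight, h3, smul_mul_assoc, smul_mul_assoc, ← pow_add, ← pow_add]
  rw [show (j' * (k * j' + k - r)).toNat + a = (j * (k * j + k - r)).toNat + b by omega]
  simp

/-- By the Pascal rule the difference of the two sides is a sum whose terms cancel in pairs under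
`lowerSwap`, which replaces the lower index by its complement in n. -/
theorem imageSum_lower (hr : 0 < r) (hrk : r ≤ k) {n : ℕ} {m : ℤ} (hm : 2 * m = n + r) :
    imageSum k r (n + 1) m = imageSum k r n (m - 1) := by
  have hrk' : r < 2 * k := by omega
  have F := fun n m => imageSum_support_finite hr hrk' n m (imageWeight k r)
  rw [← sub_eq_zero, imageSum, imageSum, ← finsum_sub_distrib (F _ _) (F _ _)]
  refine (finsum_congr fun j => ?_).trans (finsum_eq_zero_of_equiv_neg (f := fun j =>
    imageWeight k r j * X ^ (m - imageShift k r j).toNat * qBinomInt n (m - imageShift k r j))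
    lowerSwap fun j => ?_)
  · rw [qBinomInt_succ, show m - imageShift k r j - 1 = m - 1 - imageShift k r j by ring]
    ring
  · have e : m - imageShift k r (lowerSwap j) = n - (m - imageShift k r j) := by
      rw [imageShift_lowerSwap]; linarith
    rw [e, qBinomInt_symm]
    -- Outside [0, n] the binomial vanishes; inside, `toNat` loses nothing.
    rcases lt_or_ge (m - imageShift k r j) 0 with h1 | h1
    · simp [qBinomInt_of_neg h1]
    rcases lt_or_ge (n : ℤ) (m - imageShift k r j) with h2 | h2
    · simp [qBinomInt_of_lt h2]
    rw [← neg_mul]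
    congr 1
    refine imageWeight_mul_pow_eq_neg hrk ?_ ?_
    · simp only [lowerSwap, Equiv.coe_fn_mk]
      split_ifs <;> rw [Int.odd_iff] <;> omega
    · rw [Int.toNat_of_nonneg h1, Int.toNat_of_nonneg (by omega)]
      rcases int_eq_even_or_odd j with ⟨i, rfl⟩ | ⟨i, rfl⟩
      · rw [imageShift_even, show lowerSwap (2 * i) = 2 * i - 1 by simp [lowerSwap]]
        linear_combination -hm
      · rw [imageShift_odd, show lowerSwap (2 * i - 1) = 2 * i by
          simp [lowerSwap]]
        linear_combination -hm

/-- As for the lower boundary, but with the other Pascal rule and `upperSwap`. -/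
theorem imageSum_upper (hr : 0 < r) (hrk : r ≤ k) {n : ℕ} {m : ℤ}
    (hm : 2 * m = n + r + 2 - 2 * k) :
    imageSum k r (n + 1) m = imageSum k r n m := by
  have hrk' : r < 2 * k := by omega
  have F := fun n m => imageSum_support_finite hr hrk' n m (imageWeight k r)
  rw [← sub_eq_zero, imageSum, imageSum, ← finsum_sub_distrib (F _ _) (F _ _)]
  refine (finsum_congr fun j => ?_).trans (finsum_eq_zero_of_equiv_neg (f := fun j =>
    imageWeight k r j * X ^ (n - (m - 1 - imageShift k r j)).toNat *
      qBinomInt n (m - 1 - imageShift k r j))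
    upperSwap fun j => ?_)
  · rw [qBinomInt_succ', show m - imageShift k r j - 1 = m - 1 - imageShift k r j by ring,
      show (n : ℤ) + 1 - (m - imageShift k r j) = n - (m - 1 - imageShift k r j) by ring]
    ring
  · have e : m - 1 - imageShift k r (upperSwap j) = n - (m - 1 - imageShift k r j) := by
      rw [imageShift_upperSwap]; linarith
    rw [e, qBinomInt_symm]
    rcases lt_or_ge (m - 1 - imageShift k r j) 0 with h1 | h1
    · simp [qBinomInt_of_neg h1]
    rcases lt_or_ge (n : ℤ) (m - 1 - imageShift k r j) with h2 | h2
    · simp [qBinomInt_of_lt h2]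
    rw [← neg_mul]
    congr 1
    refine imageWeight_mul_pow_eq_neg hrk ?_ ?_
    · simp only [upperSwap, Equiv.coe_fn_mk]
      split_ifs <;> rw [Int.odd_iff] <;> omega
    · rw [Int.toNat_of_nonneg (by omega), Int.toNat_of_nonneg (by omega)]
      rcases int_eq_even_or_odd j with ⟨i, rfl⟩ | ⟨i, rfl⟩
      · rw [imageShift_even, show upperSwap (2 * i) = 2 * i + 1 by simp [upperSwap]]
        linear_combination hm
      · rw [imageShift_odd, show upperSwap (2 * i - 1) = 2 * i - 2 by
          simp only [upperSwap, Equiv.coe_fn_mk, Int.even_iff]; split_ifs <;> omega]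
        linear_combination hm

/-- The range of `m` is so narrow that only the image j = 0 can contribute. -/
theorem imageSum_zero (hr : 0 < r) (hrk : r < 2 * k) {m : ℤ} (hm : m < r)
    (hm' : (r : ℤ) - 2 * k < m) : imageSum k r 0 m = if m = 0 then 1 else 0 := by
  have h1 : (0 : ℤ) < r := by exact_mod_cast hr
  have h2 : (r : ℤ) < 2 * k := by exact_mod_cast hrk
  rw [imageSum, finsum_eq_single _ 0]
  · have e : imageShift k r 0 = 0 := by simp [imageShift]
    rw [e, sub_zero]
    split_ifs with h
    · simp [imageWeight, h, qBinomInt, qBinom]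
    · rcases lt_or_gt_of_ne h with h | h
      · simp [qBinomInt_of_neg h]
      · rw [qBinomInt_of_lt (by simpa using h), mul_zero]
  · intro j hj
    have : m - imageShift k r j ≠ 0 := by
      rcases int_eq_even_or_odd j with ⟨i, rfl⟩ | ⟨i, rfl⟩
      · rw [imageShift_even]
        rcases lt_trichotomy i 0 with hi | rfl | hi
        · nlinarith
        · simp at hj
        · nlinarith
      · rw [imageShift_odd]
        rcases le_or_gt i 0 with hi | hi
        · nlinarith
        · nlinarith
    rcases lt_or_gt_of_ne this with h | h
    · rw [qBinomInt_of_neg h, mul_zero]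
    · rw [qBinomInt_of_lt (by simpa using h), mul_zero]

/-- Terms with even j agree as they stand, those with odd j after the symmetry of the q-binomial. -/
theorem finitizedSum_eq_imageSum (hrk : r ≤ k) (N : ℕ) :
    finitizedSum N k r = imageSum k r (2 * N + k - r) N := by
  refine finsum_congr fun j => ?_
  rw [finitizedTerm, imageWeight, smul_mul_assoc]
  congr 2
  rcases int_eq_even_or_odd j with ⟨i, rfl⟩ | ⟨i, rfl⟩
  · rw [imageShift_even]; congr 1; ring
  · rw [imageShift_odd, ← qBinomInt_symm]
    congr 1
    rw [Nat.cast_sub (by omega)]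
    push_cast; ring

end

/-! ### Peak lists and their recurrence -/

/-- The height of the lattice path peak at position `a` that encodes a part `a` of color `c`. -/
def peakHeight (r a c : ℕ) : ℤ := if a % 2 = r % 2 then 2 * c else 2 * c - 1

/-- A peak of height `h` at `b` can precede a peak of height `y` at `x`:
`x - b ≥ 2 + |y - h|`. -/
def PeakBefore (b h x y : ℤ) : Prop := y + b + 2 ≤ x + h ∧ h + b + 2 ≤ x + y

/-- The parts and colors encode, from right to left, the peaks of a path with peak heights in
`[1, 2k - 3]`, between the virtual peaks `(-1, r - 1)` and `(x, y)`. -/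
def IsPeakList (k r : ℕ) : ℤ → ℤ → List (ℕ × ℕ) → Prop
  | x, y, [] => PeakBefore (-1) (r - 1) x y
  | x, y, p :: l => PeakBefore p.1 (peakHeight r p.1 p.2) x y ∧
      1 ≤ peakHeight r p.1 p.2 ∧ peakHeight r p.1 p.2 ≤ 2 * k - 3 ∧
      IsPeakList k r p.1 (peakHeight r p.1 p.2) l

/-- The lists of peaks below the virtual peak `(x, y)`. -/
def peakLists (k r : ℕ) (x y : ℤ) : Set (List (ℕ × ℕ)) := {l | IsPeakList k r x y l}

/-- Their generating function. -/
noncomputable def peakGenFun (k r : ℕ) (x y : ℤ) : ℤ[X] :=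
  ∑ᶠ l ∈ peakLists k r x y, X ^ (l.map Prod.fst).sum

section

variable {k r : ℕ}

theorem peakHeight_cases (r a c : ℕ) :
    a % 2 = r % 2 ∧ peakHeight r a c = 2 * c ∨ a % 2 ≠ r % 2 ∧ peakHeight r a c = 2 * c - 1 := by
  unfold peakHeight; split_ifs with h <;> simp [h]

theorem peakLists_zero (y : ℤ) : peakLists k r 0 y = ∅ := by
  ext l
  rcases l with _ | ⟨p, l⟩ <;>
    simp only [peakLists, IsPeakList, PeakBefore, Set.mem_ofPred_eq, Set.mem_empty_iff_false,
      iff_false] <;>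
    omega

theorem peakLists_one (y : ℤ) : peakLists k r 1 y = if y = r - 1 then {[]} else ∅ := by
  ext l
  split_ifs with h <;> rcases l with _ | ⟨p, l⟩ <;>
    simp [peakLists, IsPeakList, PeakBefore] <;> omega

/-- In the coordinates x + y and x - y, `PeakBefore` is a product order, so the peaks allowed before
a point form a quadrant. The quadrant of (n + 2, y) is the union of those of (n + 1, y ± 1) and, by
parity, the single extra point (n, y). -/
theorem peakLists_add_two {n : ℕ} {y : ℤ} (hp : (n + y) % 2 = r % 2) (hy : 1 ≤ y)
    (hy' : y ≤ 2 * k - 3) :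
    peakLists k r (n + 2) y = (peakLists k r (n + 1) (y - 1) ∪ peakLists k r (n + 1) (y + 1)) ∪
      List.cons (n, (y.toNat + 1) / 2) '' peakLists k r n y := by
  -- The only color that gives a peak at `n` the height `y`.
  have hn : peakHeight r n ((y.toNat + 1) / 2) = y := by
    rcases peakHeight_cases r n ((y.toNat + 1) / 2) with h | h <;> omega
  ext l
  rcases l with _ | ⟨⟨a, c⟩, l⟩
  · simp only [peakLists, IsPeakList, PeakBefore, Set.mem_ofPred_eq, Set.mem_union, Set.mem_image,
      reduceCtorEq, and_false, exists_false, or_false]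
    omega
  · simp only [peakLists, IsPeakList, PeakBefore, Set.mem_ofPred_eq, Set.mem_union, Set.mem_image,
      List.cons.injEq, Prod.mk.injEq]
    constructor
    · rintro ⟨⟨h1, h2⟩, h3, h4, h5⟩
      have := peakHeight_cases r a c
      by_cases h : a = n ∧ peakHeight r a c = y
      · obtain ⟨rfl, h⟩ := h
        exact .inr ⟨l, h ▸ h5, ⟨rfl, by omega⟩, rfl⟩
      · by_cases h' : y ≤ peakHeight r a c
        · exact .inl (.inr ⟨by omega, h3, h4, h5⟩)
        · exact .inl (.inl ⟨by omega, h3, h4, h5⟩)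
    · rintro ((⟨h1, h2, h3, h4⟩ | ⟨h1, h2, h3, h4⟩) | ⟨l', h, ⟨rfl, rfl⟩, rfl⟩)
      · exact ⟨by omega, h2, h3, h4⟩
      · exact ⟨by omega, h2, h3, h4⟩
      · rw [hn]
        exact ⟨by omega, hy, hy', h⟩

theorem peakLists_inter {n : ℕ} {y : ℤ} (hp : (n + y) % 2 = r % 2) :
    peakLists k r (n + 1) (y - 1) ∩ peakLists k r (n + 1) (y + 1) = peakLists k r n y := by
  ext l
  rcases l with _ | ⟨⟨a, c⟩, l⟩
  · simp only [peakLists, IsPeakList, PeakBefore, Set.mem_ofPred_eq, Set.mem_inter_iff]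
    omega
  · simp only [peakLists, IsPeakList, PeakBefore, Set.mem_ofPred_eq, Set.mem_inter_iff]
    have := peakHeight_cases r a c
    constructor
    · rintro ⟨⟨h1, h2, h3, h4⟩, h5, -⟩
      exact ⟨by omega, h2, h3, h4⟩
    · rintro ⟨h1, h2, h3, h4⟩
      exact ⟨⟨by omega, h2, h3, h4⟩, by omega, h2, h3, h4⟩

theorem peakLists_disjoint (n c : ℕ) (y : ℤ) :
    Disjoint (peakLists k r (n + 1) (y - 1) ∪ peakLists k r (n + 1) (y + 1))
      (List.cons (n, c) '' peakLists k r n y) := by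
  rw [Set.disjoint_right]
  rintro _ ⟨l, -, rfl⟩
  simp only [peakLists, IsPeakList, PeakBefore, Set.mem_ofPred_eq, Set.mem_union]
  omega

/-- Heights of peaks are at least 1, which makes the extra inequality automatic; for the empty list
with r = 1 parity takes over. -/
theorem peakLists_lower (hr : 0 < r) {n : ℕ} (hp : (n : ℤ) % 2 = r % 2) :
    peakLists k r (n + 2) 0 = peakLists k r (n + 1) 1 := by
  ext l
  rcases l with _ | ⟨⟨a, c⟩, l⟩ <;>
    simp only [peakLists, IsPeakList, PeakBefore, Set.mem_ofPred_eq]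
  · omega
  · refine and_congr_left fun h => ?_
    omega

theorem peakLists_upper (hk : 2 ≤ k) (hrk : r ≤ k) (n : ℕ) :
    peakLists k r (n + 2) (2 * k - 2) = peakLists k r (n + 1) (2 * k - 3) := by
  ext l
  rcases l with _ | ⟨⟨a, c⟩, l⟩ <;>
    simp only [peakLists, IsPeakList, PeakBefore, Set.mem_ofPred_eq]
  · omega
  · refine and_congr_left fun h => ?_
    omega

theorem peakLists_finite (hr : 0 < r) (hk : 2 ≤ k) (hrk : r ≤ k) (n : ℕ) :
    ∀ y : ℤ, 0 ≤ y → y ≤ 2 * k - 2 → (n + y + r) % 2 = 0 → (peakLists k r n y).Finite := by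
  induction n using Nat.twoStepInduction with
  | zero => intro y _ _ _; simp [peakLists_zero]
  | one =>
    intro y _ _ _
    rw [Nat.cast_one, peakLists_one]
    split_ifs <;> simp
  | more n ih1 ih2 =>
    intro y h0 h1 hp
    push_cast at hp ih2 ⊢
    rcases h0.eq_or_lt with rfl | h0
    · rw [peakLists_lower hr (by omega)]
      exact ih2 1 (by omega) (by omega) (by omega)
    rcases h1.eq_or_lt with rfl | h1
    · rw [peakLists_upper hk hrk]
      exact ih2 _ (by omega) (by omega) (by omega)
    rw [peakLists_add_two (by omega) (by omega) (by omega)]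
    exact ((ih2 _ (by omega) (by omega) (by omega)).union
      (ih2 _ (by omega) (by omega) (by omega))).union
      ((ih1 _ (by omega) (by omega) (by omega)).image _)

theorem peakGenFun_recurrence (hr : 0 < r) (hk : 2 ≤ k) (hrk : r ≤ k) {n : ℕ} {y : ℤ}
    (hp : (n + y + r) % 2 = 0) (hy : 1 ≤ y) (hy' : y ≤ 2 * k - 3) :
    peakGenFun k r (n + 2) y = peakGenFun k r (n + 1) (y - 1) + peakGenFun k r (n + 1) (y + 1) -
      (1 - X ^ n) * peakGenFun k r n y := by
  have F := peakLists_finite hr hk hrk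
  have f0 := F n y (by omega) (by omega) hp
  have f1 := F (n + 1) (y - 1) (by omega) (by omega) (by push_cast; omega)
  have f2 := F (n + 1) (y + 1) (by omega) (by omega) (by push_cast; omega)
  push_cast at f1 f2
  have h1 := finsum_mem_union_inter (f := fun l => (X : ℤ[X]) ^ (l.map Prod.fst).sum) f1 f2
  rw [peakLists_inter (by omega)] at h1
  have h2 : ∑ᶠ l ∈ List.cons (n, (y.toNat + 1) / 2) '' peakLists k r n y,
      (X : ℤ[X]) ^ (l.map Prod.fst).sum = X ^ n * peakGenFun k r n y := by
    rw [finsum_mem_image (List.cons_injective.injOn), peakGenFun, mul_finsum_mem]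
    simp [pow_add]
  rw [peakGenFun, peakLists_add_two (by omega) hy hy',
    finsum_mem_union (peakLists_disjoint n _ y) (f1.union f2) (f0.image _), h2]
  unfold peakGenFun at *
  linear_combination h1

theorem peakGenFun_eq_imageSum (hr : 0 < r) (hk : 2 ≤ k) (hrk : r ≤ k) (n : ℕ) :
    ∀ y m : ℤ, 0 ≤ y → y ≤ 2 * k - 2 → 2 * m = n - y + r - 1 →
      peakGenFun k r (n + 1) y = imageSum k r n m := by
  have hrk' : r < 2 * k := by omega
  induction n using Nat.strong_induction_on with
  | _ n ih =>
  intro y m h0 h1 hm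
  rcases n with _ | n
  · rw [imageSum_zero hr hrk' (by omega) (by omega), peakGenFun]
    simp only [Nat.cast_zero, zero_add, peakLists_one]
    split_ifs
    · simp
    · omega
    · omega
    · simp
  have e : ((n + 1 : ℕ) : ℤ) + 1 = n + 2 := by push_cast; ring
  have ih1 := ih n (by omega)
  rw [e]
  push_cast at hm
  rcases h0.eq_or_lt with rfl | h0
  · rw [imageSum_lower hr hrk (by omega), ← ih1 1 (m - 1) (by omega) (by omega) (by omega),
      peakGenFun, peakLists_lower hr (by omega), peakGenFun]
  rcases h1.eq_or_lt with rfl | h1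
  · rw [imageSum_upper hr hrk (by omega), ← ih1 (2 * k - 3) m (by omega) (by omega) (by omega),
      peakGenFun, peakLists_upper hk hrk, peakGenFun]
  rw [peakGenFun_recurrence hr hk hrk (by omega) (by omega) (by omega),
    imageSum_recurrence hr hrk', ih1 (y - 1) m (by omega) (by omega) (by omega),
    ih1 (y + 1) (m - 1) (by omega) (by omega) (by omega)]
  -- At position 0 the factor 1 - X ^ 0 removes the last term, so no induction hypothesis is needed
  -- there.
  rcases n with _ | n
  · simp
  · rw [Nat.add_sub_cancel,
      ← ih n (by omega) y (m - 1) (by omega) (by omega) (by push_cast at hm; omega)]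
    push_cast
    rfl

end

/-- `PeakBefore` is transitive; hence the initial condition on every part follows from the one on
the smallest. -/
theorem IsPeakList.peakBefore_start {k r : ℕ} {x y : ℤ} {l : List (ℕ × ℕ)}
    (h : IsPeakList k r x y l) : PeakBefore (-1) (r - 1) x y := by
  induction l generalizing x y with
  | nil => exact h
  | cons p l ih =>
    have h1 := ih h.2.2.2
    have h2 := h.1
    unfold PeakBefore at *
    omega

/-! ### Color partitions as peak lists -/

namespace ColorPartition

variable {k r : ℕ}

theorem initialCondition_iff (r a c : ℕ) :
    InitialCondition r a c ↔ PeakBefore (-1) (r - 1) a (peakHeight r a c) := by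
  simp only [InitialCondition, PeakBefore, gt_iff_lt, abs_lt, Nat.ModEq]
  rcases peakHeight_cases r a c with h | h <;> omega

theorem differenceCondition_iff (r a c b d : ℕ) :
    DifferenceCondition r a c b d ↔
      PeakBefore b (peakHeight r b d) a (peakHeight r a c) := by
  simp only [DifferenceCondition, PeakBefore, ge_iff_le, ← le_sub_iff_add_le', abs_le, Nat.ModEq]
  rcases peakHeight_cases r a c with h | h <;> rcases peakHeight_cases r b d with h' | h' <;> omega

theorem parityCondition_iff {a c : ℕ} :
    (1 ≤ c ∧ c ≤ 2 * k / 2 - 1) ∧ ParityCondition (2 * k) r a c ↔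
      1 ≤ peakHeight r a c ∧ peakHeight r a c ≤ 2 * k - 3 := by
  simp only [ParityCondition, even_two_mul, true_imp_iff, Nat.ModEq]
  rcases peakHeight_cases r a c with h | h <;> omega

/-- The halves turn the absolute value into max(2c - k, k - 2c - 1). The remaining off-by-one is
absorbed by the parity of `a` plus its height. -/
theorem firstPartBound_iff {N a c : ℕ} :
    (2 * (N : ℚ) + k - r - 1) - a ≥ |2 * (c : ℚ) - k + 1 / 2| - 1 / 2 ↔
      PeakBefore a (peakHeight r a c) (2 * N + k - r + 1) (k - 1) := by
  have e : (2 * (N : ℚ) + k - r - 1) - a ≥ |2 * (c : ℚ) - k + 1 / 2| - 1 / 2 ↔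
      2 * (c : ℤ) - k ≤ 2 * N + k - r - 1 - a ∧
        -(2 * (c : ℤ) - k) - 1 ≤ 2 * N + k - r - 1 - a := by
    rw [ge_iff_le, sub_le_iff_le_add, abs_le', ← @Int.cast_le ℚ, ← @Int.cast_le ℚ]
    push_cast
    constructor <;> rintro ⟨h1, h2⟩ <;> constructor <;> linarith
  rw [e, PeakBefore]
  rcases peakHeight_cases r a c with h | h <;> omega

/-- The conditions of a color partition in `C (2 * k) r n`, for its list of parts and colors. -/
theorem isPeakList_iff {x y : ℤ} (l : List (ℕ × ℕ)) (h0 : PeakBefore (-1) (r - 1) x y) :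
    IsPeakList k r x y l ↔
      (∀ p ∈ l, 1 ≤ p.2 ∧ p.2 ≤ 2 * k / 2 - 1) ∧
      (∀ p ∈ l, InitialCondition r p.1 p.2) ∧
      l.IsChain (fun p q => DifferenceCondition r p.1 p.2 q.1 q.2) ∧
      (∀ p ∈ l, ParityCondition (2 * k) r p.1 p.2) ∧
      ∀ p ∈ l.head?, PeakBefore p.1 (peakHeight r p.1 p.2) x y := by
  induction l generalizing x y with
  | nil => simpa [IsPeakList] using h0
  | cons p l ih =>
    simp only [IsPeakList, List.forall_mem_cons, List.isChain_cons, List.head?_cons,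
      Option.mem_some_iff, forall_eq']
    have hi := initialCondition_iff r p.1 p.2
    have hp := parityCondition_iff (k := k) (r := r) (a := p.1) (c := p.2)
    simp only [differenceCondition_iff] at ih ⊢
    constructor
    · rintro ⟨h1, h2, h3, h4⟩
      have h5 := h4.peakBefore_start
      have := (ih h5).1 h4
      have := hi.2 h5
      have := hp.2 ⟨h2, h3⟩
      tauto
    · rintro ⟨⟨h1, h2⟩, ⟨h3, h4⟩, ⟨h5, h6⟩, ⟨h7, h8⟩, h9⟩
      obtain ⟨h10, h11⟩ := hp.1 ⟨h1, h7⟩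
      exact ⟨h9, h10, h11, (ih (hi.1 h3)).2 ⟨h2, h4, h6, h8, h5⟩⟩

theorem toList_injective (t n : ℕ) : Function.Injective (toList : ColorPartition t n → _) :=
  fun _ _ h => ColorPartition.ext h

theorem mem_C_and_firstPartBound_iff (hrk : r ≤ k) {n : ℕ} (N : ℕ)
    (p : ColorPartition (2 * k / 2 - 1) n) :
    p ∈ C (2 * k) r n ∧ p.FirstPartBound N k r ↔
      IsPeakList k r (2 * N + k - r + 1) (k - 1) p.toList := by
  rw [isPeakList_iff _ (by unfold PeakBefore; omega)]
  have := p.color_mem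
  simp only [C, FirstPartBound, Set.mem_ofPred_eq, firstPartBound_iff (r := r)]
  tauto

/-- Positivity and ordering come for free: consecutive parts differ by at least 2, so the rule on
colors of equal parts is vacuous. -/
theorem image_toList_eq (hrk : r ≤ k) (N n : ℕ) :
    toList '' {p ∈ C (2 * k) r n | p.FirstPartBound N k r} =
      {l ∈ peakLists k r (2 * N + k - r + 1) (k - 1) | (l.map Prod.fst).sum = n} := by
  ext l
  constructor
  · rintro ⟨p, hp, rfl⟩
    exact ⟨(mem_C_and_firstPartBound_iff hrk N p).1 hp, p.sum_eq⟩
  · rintro ⟨hl, hn⟩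
    have h0 : PeakBefore (-1) (r - 1) (2 * N + k - r + 1) (k - 1) := by unfold PeakBefore; omega
    obtain ⟨h1, h2, h3, -⟩ := (isPeakList_iff l h0).1 hl
    refine ⟨⟨l, fun p hp => ?_, h1, h3.imp fun p q h => ?_, hn⟩,
      (mem_C_and_firstPartBound_iff hrk N _).2 hl, rfl⟩
    · have := (initialCondition_iff _ _ _).1 (h2 p hp)
      unfold PeakBefore at this
      omega
    · have := (differenceCondition_iff _ _ _ _ _).1 h
      unfold PeakBefore at this
      omega

end ColorPartition

/-! ### Comparison of coefficients -/

theorem coeff_finsum_mem_X_pow {α : Type*} {s : Set α} (hs : s.Finite) (w : α → ℕ) (n : ℕ) :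
    (∑ᶠ a ∈ s, (X : ℤ[X]) ^ w a).coeff n = ({a ∈ s | w a = n}.ncard : ℤ) := by
  classical
  have e : {a ∈ s | w a = n} = (hs.toFinset.filter fun a => n = w a : Finset α) := by
    ext a; simp [eq_comm]
  rw [finsum_mem_eq_finite_toFinset_sum _ hs, finsetSum_coeff, e, Set.ncard_coe_finset]
  simp [coeff_X_pow]

theorem mainTheorem5 (k r N : ℕ) (hk : 2 ≤ k) (hr : 0 < r) (hrk : r ≤ k) :
    (∀ n : ℕ, {p ∈ ColorPartition.C (2 * k) r n | p.FirstPartBound N k r}.Finite) ∧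
    ((finitizedSum N k r : ℤ[X]) : PowerSeries ℤ) =
      PowerSeries.mk fun n : ℕ =>
        ({p ∈ ColorPartition.C (2 * k) r n | p.FirstPartBound N k r}.ncard : ℤ) := by
  have e : ((2 * N + k - r : ℕ) : ℤ) + 1 = 2 * N + k - r + 1 := by omega
  have hf : (peakLists k r (2 * N + k - r + 1) (k - 1)).Finite := by
    have := peakLists_finite hr hk hrk (2 * N + k - r + 1) (k - 1) (by omega) (by omega) (by omega)
    rwa [Nat.cast_add_one, e] at this
  have hi := ColorPartition.toList_injective
  refine ⟨fun n => ?_, ?_⟩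
  · refine Set.Finite.of_finite_image ?_ (hi _ _).injOn
    rw [ColorPartition.image_toList_eq hrk]
    exact hf.subset fun l h => h.1
  · ext n
    rw [coeff_coe, PowerSeries.coeff_mk, finitizedSum_eq_imageSum hrk,
      ← peakGenFun_eq_imageSum hr hk hrk _ (k - 1) N (by omega) (by omega) (by omega), e,
      peakGenFun, coeff_finsum_mem_X_pow hf, ← ColorPartition.image_toList_eq hrk,
      Set.ncard_image_of_injective _ (hi _ _)]
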